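/- A server is connected to $H\ge 1$ relays, and the relays to $K\ge 1$ users, by a network connection matrix $G\in\{0,1\}^{H\times K}$. Let $\mathcal N_i=\{k\in[K]:G(i,k)=1\}$ be the set of users connected to relay $i$, assume $\bigcup_{i}\mathcal N_i=[K]$, and let $\mathcal I_z$ be the set of users connected to exactly $z$ relays. Communication model. User $k$ holds an intermediate value $\mathbf v_k$ of $V$ bits and sends a message depending on $\mathbf v_k$ to the relays connected to it. From the messages of its users, relay $i$ computes its local intermediate values and a message $X_i$ of $T_i$ bits, which it sends to the server. The server broadcasts to all relays a message $X_0$ of $T_0$ bits that depends on $(X_1,\dots,X_H)$. Each relay must recover $(\mathbf v_1,\dots,\mathbf v_K)$ from $X_0$ and its local values; from the same data it also generates a message to its users, and each user $k$ must recover its updated model $\mathbf w_k$ from the messages of the relays connected to it, where $(\mathbf w_1,\dots,\mathbf w_K)=\phi(\mathbf v_1,\dots,\mathbf v_K)$ for a given, arbitrary global update function $\phi$ (one for each size $V$). A choice of all encoders and decoders is a correct scheme if this works for all values of $\mathbf v_1,\dots,\mathbf v_K$. Its uplink load is $\sum_{i=1}^H T_i/V$ and its downlink load is $T_0/V$. Let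 $L_{\mathrm{up}}^{*}$ and $L_{\mathrm{down}}^{*}$ be the optimal loads, i.e. the infima of the uplink load and of the downlink load, respectively, over all $V\ge 1$ and all correct schemes. Loads of the coded scheme. Put $$L_{\mathrm{up}}=\sum_{z=1}^{H-1}\sum_{i=1}^{H}\alpha_i^z\Bigl(|\mathcal N_i\cap\mathcal I_z|-\min_{j\in[H]}|\mathcal N_i\cap\mathcal N_j\cap\mathcal I_z|\Bigr),\qquad L_{\mathrm{down}}=K-\sum_{z=1}^{H-1}\min_{i\in[H]}|\mathcal N_i\cap\mathcal I_z|,$$ where, for each $z\in[H-1]$, $(\alpha_i^z)_{i\in[H]}$ is an optimal solution of the linear program that minimizes $\sum_{i}\alpha_i^z\bigl(|\mathcal N_i\cap\mathcal I_z|-\min_{j}|\mathcal N_i\cap\mathcal N_j\cap\mathcal I_z|\bigr)$ subject to $\sum_{i:\,k\in\mathcal N_i}\alpha_i^z\ge 1$ for all $k\in\mathcal I_z$ and $0\le\alpha_i^z\le 1$ for all $i\in[H]$. Then $$L_{\mathrm{up}}-L_{\mathrm{up}}^{*}\le\min_{i\in[H]}|\mathcal N_i|-\sum_{z=1}^{H-1}\sum_{i=1}^{H}\frac1z\min_{j\in[H]}|\mathcal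 N_i\cap\mathcal N_j\cap\mathcal I_z|\le\min_{i\in[H]}|\mathcal N_i|,$$ $$L_{\mathrm{down}}-L_{\mathrm{down}}^{*}\le\min_{i\in[H]}|\mathcal N_i|-\sum_{z=1}^{H-1}\min_{i\in[H]}|\mathcal N_i\cap\mathcal I_z|\le\min_{i\in[H]}|\mathcal N_i|.$$ In particular both gaps are at most the minimum number of users connected to any relay. -/

import Mathlib

namespace HierMTL

noncomputable section

/-! ### Network topology -/

/-- `𝒩 i`: the users connected to relay `i`, for the network connection matrix `G`
(`G i k = 1` if relay `i` and user `k` are connected, `G i k = 0` otherwise). -/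
def nbr {H K : ℕ} (G : Matrix (Fin H) (Fin K) ℕ) (i : Fin H) : Finset (Fin K) :=
  Finset.univ.filter fun k => G i k = 1

/-- `r k`: the connectivity of user `k`, i.e. the number of relays that it is connected to. -/
def connectivity {H K : ℕ} (G : Matrix (Fin H) (Fin K) ℕ) (k : Fin K) : ℕ :=
  (Finset.univ.filter fun i => k ∈ nbr G i).card

/-- `ℐ z`: the `z`-connected users, those connected to exactly `z` relays. -/
def zConn {H K : ℕ} (G : Matrix (Fin H) (Fin K) ℕ) (z : ℕ) : Finset (Fin K) :=
  Finset.univ.filter fun k => connectivity G k = z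

/-- `min_i |𝒩 i|`. -/
def minUsers {H K : ℕ} (G : Matrix (Fin H) (Fin K) ℕ) : ℕ :=
  ⨅ i : Fin H, (nbr G i).card

/-- `min_i |𝒩 i ∩ ℐ z|`. -/
def minLocal {H K : ℕ} (G : Matrix (Fin H) (Fin K) ℕ) (z : ℕ) : ℕ :=
  ⨅ i : Fin H, (nbr G i ∩ zConn G z).card

/-- `min_j |𝒩 i ∩ 𝒩 j ∩ ℐ z|`, the minimum being over all relays `j`. -/
def minCommon {H K : ℕ} (G : Matrix (Fin H) (Fin K) ℕ) (z : ℕ) (i : Fin H) : ℕ :=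
  ⨅ j : Fin H, (nbr G i ∩ nbr G j ∩ zConn G z).card

/-! ### Loads of the coded scheme -/

/-- `n i z = |𝒩 i ∩ ℐ z| - min_j |𝒩 i ∩ 𝒩 j ∩ ℐ z|`, the number of combinations that relay `i`
sends in round `z`. -/
def numComb {H K : ℕ} (G : Matrix (Fin H) (Fin K) ℕ) (z : ℕ) (i : Fin H) : ℝ :=
  ((nbr G i ∩ zConn G z).card : ℝ) - (minCommon G z i : ℝ)

/-- Uplink load of round `z` when relay `i` is responsible for a fraction `a i` of each
intermediate value. -/
def roundLoad {H K : ℕ} (G : Matrix (Fin H) (Fin K) ℕ) (z : ℕ) (a : Fin H → ℝ) : ℝ :=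
  ∑ i, a i * numComb G z i

/-- The constraints of the linear program of round `z`: the fractions lie in `[0, 1]`, and every
value of a user in `ℐ z` (the values that round `z` delivers) is completely covered by the relays
that know it. -/
def Feasible {H K : ℕ} (G : Matrix (Fin H) (Fin K) ℕ) (z : ℕ) (a : Fin H → ℝ) : Prop :=
  (∀ k ∈ zConn G z, 1 ≤ ∑ i, if k ∈ nbr G i then a i else 0) ∧ ∀ i, 0 ≤ a i ∧ a i ≤ 1

/-- `a` is an optimal solution of the linear program of round `z`. -/
def IsOptimalSplit {H K : ℕ} (G : Matrix (Fin H) (Fin K) ℕ) (z : ℕ) (a : Fin H → ℝ) : Prop :=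
  Feasible G z a ∧ ∀ b, Feasible G z b → roundLoad G z a ≤ roundLoad G z b

/-- The linear program of every round `z ≥ 1` has an optimal solution. -/
theorem exists_isOptimalSplit {H K : ℕ} (G : Matrix (Fin H) (Fin K) ℕ) {z : ℕ} (hz : 1 ≤ z) :
    ∃ a, IsOptimalSplit G z a := by
  have hcomp : IsCompact {a : Fin H → ℝ | Feasible G z a} := by
    refine IsCompact.of_isClosed_subset (isCompact_Icc (a := (0 : Fin H → ℝ)) (b := 1)) ?_ ?_
    · have h : {a : Fin H → ℝ | Feasible G z a} =
          (⋂ k ∈ zConn G z, {a | 1 ≤ ∑ i, if k ∈ nbr G i then a i else 0}) ∩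
            ⋂ i, {a | 0 ≤ a i ∧ a i ≤ 1} := by
        ext a
        simp [Feasible]
      rw [h]
      refine IsClosed.inter (isClosed_biInter fun k _ => ?_) (isClosed_iInter fun i => ?_)
      · refine isClosed_le continuous_const (continuous_finsetSum _ fun i _ => ?_)
        split_ifs <;> fun_prop
      · exact (isClosed_le continuous_const (continuous_apply i)).inter
          (isClosed_le (continuous_apply i) continuous_const)
    · intro a ha
      exact ⟨fun i => (ha.2 i).1, fun i => (ha.2 i).2⟩
  have hne : {a : Fin H → ℝ | Feasible G z a}.Nonempty := by
    refine ⟨fun _ => 1, fun k hk => ?_, fun i => by norm_num⟩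
    have h : connectivity G k = z := by simpa [zConn] using hk
    rw [← Finset.sum_filter]
    simp only [Finset.sum_const, nsmul_eq_mul, mul_one]
    have : 1 ≤ (Finset.univ.filter fun i => k ∈ nbr G i).card := by
      rw [connectivity] at h
      omega
    exact_mod_cast this
  have hcont : ContinuousOn (roundLoad G z) {a : Fin H → ℝ | Feasible G z a} := by
    unfold roundLoad
    fun_prop
  obtain ⟨a, ha, hmin⟩ := hcomp.exists_isMinOn hne hcont
  exact ⟨a, ha, fun b hb => hmin hb⟩

/-- The uplink load (relays to server) of the coded scheme with fractions `α z i`. -/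
def codedUplinkLoad {H K : ℕ} (G : Matrix (Fin H) (Fin K) ℕ) (α : ℕ → Fin H → ℝ) : ℝ :=
  ∑ z ∈ Finset.Icc 1 (H - 1), roundLoad G z (α z)

/-- The downlink load (server to relays) of the coded scheme. -/
def codedDownlinkLoad {H K : ℕ} (G : Matrix (Fin H) (Fin K) ℕ) : ℝ :=
  (K : ℝ) - ∑ z ∈ Finset.Icc 1 (H - 1), (minLocal G z : ℝ)

/-! ### Communication schemes and optimal loads -/

/-- Messages of `T` bits. -/
abbrev Bits (T : ℕ) : Type := Fin T → Bool

/-- A communication scheme (all encoders and decoders of one iteration) for the network `G` and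
intermediate values of `V` bits. -/
structure Scheme {H K : ℕ} (G : Matrix (Fin H) (Fin K) ℕ) (V : ℕ) where
  /-- number of bits that user `k` sends to its relays -/
  userBits : Fin K → ℕ
  /-- number of bits that relay `i` sends to the server -/
  upBits : Fin H → ℕ
  /-- number of bits that the server broadcasts to the relays -/
  serverBits : ℕ
  /-- number of bits that relay `i` sends to its users -/
  downBits : Fin H → ℕ
  /-- number of local intermediate values stored at relay `i` -/
  localCount : Fin H → ℕ
  /-- encoder of user `k` -/
  userEnc : ∀ k, Bits V → Bits (userBits k)
  /-- local decoder of relay `i`, acting on the messages of its users -/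
  localDec : ∀ i, (∀ k : {k // k ∈ nbr G i}, Bits (userBits k)) → Fin (localCount i) → Bits V
  /-- uplink encoder of relay `i`, acting on the messages of its users -/
  upEnc : ∀ i, (∀ k : {k // k ∈ nbr G i}, Bits (userBits k)) → Bits (upBits i)
  /-- encoder of the server, acting on the uplink messages of all relays -/
  serverEnc : (∀ i, Bits (upBits i)) → Bits serverBits
  /-- decoder of relay `i`, which outputs all `K` intermediate values -/
  relayDec : ∀ i, Bits serverBits → (Fin (localCount i) → Bits V) → Fin K → Bits V
  /-- downlink encoder of relay `i` -/
  downEnc : ∀ i, Bits serverBits → (Fin (localCount i) → Bits V) → Bits (downBits i)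
  /-- decoder of user `k`, acting on the messages of the relays that it is connected to -/
  userDec : ∀ k, (∀ i : {i // k ∈ nbr G i}, Bits (downBits i)) → Bits V

namespace Scheme

/-- The messages that relay `i` receives from its users when the intermediate values are `v`. -/
def received {H K : ℕ} {G : Matrix (Fin H) (Fin K) ℕ} {V : ℕ} (S : Scheme G V)
    (v : Fin K → Bits V) (i : Fin H) : ∀ k : {k // k ∈ nbr G i}, Bits (S.userBits k) :=
  fun k => S.userEnc k (v k)

/-- The local intermediate values of relay `i`. -/
def localVals {H K : ℕ} {G : Matrix (Fin H) (Fin K) ℕ} {V : ℕ} (S : Scheme G V)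
    (v : Fin K → Bits V) (i : Fin H) : Fin (S.localCount i) → Bits V :=
  S.localDec i (S.received v i)

/-- The message that the server broadcasts. -/
def serverMsg {H K : ℕ} {G : Matrix (Fin H) (Fin K) ℕ} {V : ℕ} (S : Scheme G V)
    (v : Fin K → Bits V) : Bits S.serverBits :=
  S.serverEnc fun i => S.upEnc i (S.received v i)

/-- The message that relay `i` sends to its users. -/
def downMsg {H K : ℕ} {G : Matrix (Fin H) (Fin K) ℕ} {V : ℕ} (S : Scheme G V)
    (v : Fin K → Bits V) (i : Fin H) : Bits (S.downBits i) :=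
  S.downEnc i (S.serverMsg v) (S.localVals v i)

/-- The scheme is correct for the global update function `φ`: whatever the intermediate values,
every relay recovers all of them and every user recovers its updated model. -/
def Correct {H K : ℕ} {G : Matrix (Fin H) (Fin K) ℕ} {V : ℕ} (S : Scheme G V)
    (φ : (Fin K → Bits V) → Fin K → Bits V) : Prop :=
  ∀ v : Fin K → Bits V,
    (∀ i, S.relayDec i (S.serverMsg v) (S.localVals v i) = v) ∧
    ∀ k, S.userDec k (fun i => S.downMsg v i) = φ v k

/-- Uplink load from the relays to the server. -/
def uplinkLoad {H K : ℕ} {G : Matrix (Fin H) (Fin K) ℕ} {V : ℕ} (S : Scheme G V) : ℝ :=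
  (∑ i, (S.upBits i : ℝ)) / (V : ℝ)

/-- Downlink load from the server to the relays. -/
def downlinkLoad {H K : ℕ} {G : Matrix (Fin H) (Fin K) ℕ} {V : ℕ} (S : Scheme G V) : ℝ :=
  (S.serverBits : ℝ) / (V : ℝ)

end Scheme

/-- The optimal uplink load: the infimum of the uplink loads of all correct schemes, over all
sizes `V ≥ 1` of the intermediate values. Here `φ V` is the global update function for size `V`. -/
def optUplinkLoad {H K : ℕ} (G : Matrix (Fin H) (Fin K) ℕ)
    (φ : ∀ V : ℕ, (Fin K → Bits V) → Fin K → Bits V) : ℝ :=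
  sInf {L : ℝ | ∃ V : ℕ, 0 < V ∧ ∃ S : Scheme G V, S.Correct (φ V) ∧ L = S.uplinkLoad}

/-- The optimal downlink load: the infimum of the downlink loads of all correct schemes. -/
def optDownlinkLoad {H K : ℕ} (G : Matrix (Fin H) (Fin K) ℕ)
    (φ : ∀ V : ℕ, (Fin K → Bits V) → Fin K → Bits V) : ℝ :=
  sInf {L : ℝ | ∃ V : ℕ, 0 < V ∧ ∃ S : Scheme G V, S.Correct (φ V) ∧ L = S.downlinkLoad}

end

end HierMTL

namespace HierMTL

/-! ### Counting bits -/

/-! Both optimal loads are at least `K - minUsers G`. Fix a relay `i` and set the values of its own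
users to zero. What it hears from them is then constant, so by correctness the broadcast must
determine the other `K - |𝒩 i|` values (`serverMsg_extendOff_injective`). Counting bits bounds the
broadcast, and also the uplink messages, since the broadcast is a function of them. A relay with
fewest users gives the best bound.

The coded uplink load is bounded by testing the linear programs at the uniform split `1 / z`, whose
cost is `|ℐ z|` minus the savings (`codedUplinkLoad_le`); the classes `ℐ z` are disjoint, so their
sizes sum to at most `K`. Subtracting the two bounds cancels `K`. -/

theorem le_of_injective_bits {α : Type*} [Fintype α] {m n : ℕ} (hα : Fintype.card α = 2 ^ m)
    {β : Type*} [Fintype β] (hβ : Fintype.card β = 2 ^ n) (f : α → β)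
    (hf : Function.Injective f) : m ≤ n := by
  have h := Fintype.card_le_of_injective f hf
  rw [hα, hβ] at h
  exact (Nat.pow_le_pow_iff_right (by norm_num)).1 h

theorem card_bits (T : ℕ) : Fintype.card (Bits T) = 2 ^ T := by
  simp [Bits]

/-- Extend values of the users not connected to relay `i` by zeros on the users of relay `i`. -/
def extendOff {H K : ℕ} (G : Matrix (Fin H) (Fin K) ℕ) {V : ℕ} (i : Fin H)
    (w : {k // k ∉ nbr G i} → Bits V) : Fin K → Bits V :=
  fun k => if h : k ∈ nbr G i then fun _ => false else w ⟨k, h⟩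

theorem extendOff_injective {H K : ℕ} (G : Matrix (Fin H) (Fin K) ℕ) {V : ℕ} (i : Fin H) :
    Function.Injective (extendOff G (V := V) i) := by
  intro w w' h
  funext k
  have hk := congrFun h k.1
  simpa [extendOff, k.2] using hk

theorem card_values_off {H K : ℕ} (G : Matrix (Fin H) (Fin K) ℕ) (V : ℕ) (i : Fin H) :
    Fintype.card ({k // k ∉ nbr G i} → Bits V) = 2 ^ (V * (K - (nbr G i).card)) := by
  rw [Fintype.card_fun, card_bits, ← pow_mul, Fintype.card_subtype_compl]
  simp

/-! ### Converse bounds -/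

namespace Scheme

variable {H K : ℕ} {G : Matrix (Fin H) (Fin K) ℕ} {V : ℕ}

theorem received_extendOff (S : Scheme G V) (i : Fin H) (w w' : {k // k ∉ nbr G i} → Bits V) :
    S.received (extendOff G i w) i = S.received (extendOff G i w') i := by
  funext k
  simp [received, extendOff, k.2]

/-- A relay cannot tell apart the values of the users that it is not connected to without the
help of the server. -/
theorem serverMsg_extendOff_injective {S : Scheme G V} {φ : (Fin K → Bits V) → Fin K → Bits V}
    (hS : S.Correct φ) (i : Fin H) :
    Function.Injective fun w => S.serverMsg (extendOff G i w) := by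
  intro w w' h
  apply extendOff_injective G i
  have hl : S.localVals (extendOff G i w) i = S.localVals (extendOff G i w') i := by
    rw [localVals, S.received_extendOff i w w', localVals]
  rw [← (hS (extendOff G i w)).1 i, ← (hS (extendOff G i w')).1 i, hl]
  exact congrArg (fun x => S.relayDec i x _) h

theorem le_serverBits {S : Scheme G V} {φ : (Fin K → Bits V) → Fin K → Bits V}
    (hS : S.Correct φ) (i : Fin H) : V * (K - (nbr G i).card) ≤ S.serverBits :=
  le_of_injective_bits (card_values_off G V i) (card_bits _) _
    (serverMsg_extendOff_injective hS i)

theorem le_sum_upBits {S : Scheme G V} {φ : (Fin K → Bits V) → Fin K → Bits V}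
    (hS : S.Correct φ) (i : Fin H) : V * (K - (nbr G i).card) ≤ ∑ j, S.upBits j := by
  refine le_of_injective_bits (β := ∀ j, Bits (S.upBits j)) (card_values_off G V i) ?_
    (fun w j => S.upEnc j (S.received (extendOff G i w) j)) ?_
  · rw [Fintype.card_pi, ← Finset.prod_pow_eq_pow_sum]
    exact Finset.prod_congr rfl fun j _ => card_bits _
  -- The broadcast is `serverEnc` applied to the tuple of uplink messages, so its injectivity forces
  -- that of the tuple.
  · exact Function.Injective.of_comp (f := S.serverEnc) (serverMsg_extendOff_injective hS i)

end Scheme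

theorem le_load_of_mul_le {K n V T : ℕ} (hV : 0 < V) (h : V * (K - n) ≤ T) :
    (K : ℝ) - n ≤ (T : ℝ) / V := by
  rw [le_div_iff₀ (by exact_mod_cast hV)]
  -- Truncated subtraction can only exceed the real difference, so `n ≤ K` is not needed.
  have h1 : (K : ℝ) - n ≤ ((K - n : ℕ) : ℝ) := by
    have : K ≤ (K - n) + n := by omega
    have : (K : ℝ) ≤ ((K - n : ℕ) : ℝ) + n := by exact_mod_cast this
    linarith
  calc ((K : ℝ) - n) * V ≤ ((K - n : ℕ) : ℝ) * V := by gcongr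
    _ = ((V * (K - n) : ℕ) : ℝ) := by push_cast; ring
    _ ≤ T := by exact_mod_cast h

/-! ### The uncoded scheme -/

/-- Concatenate the values of all users. -/
def concat {K V : ℕ} (v : Fin K → Bits V) : Bits (K * V) :=
  fun m => v (finProdFinEquiv.symm m).1 (finProdFinEquiv.symm m).2

/-- Split a concatenation into the values of the users. -/
def split {K V : ℕ} (x : Bits (K * V)) : Fin K → Bits V :=
  fun k b => x (finProdFinEquiv (k, b))

theorem split_concat {K V : ℕ} (v : Fin K → Bits V) : split (concat v) = v := by
  funext k b
  simp [split, concat]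

/-- The scheme in which every node forwards everything that it knows. -/
noncomputable def uncodedScheme {H K : ℕ} (G : Matrix (Fin H) (Fin K) ℕ)
    (hcover : ∀ k : Fin K, ∃ i : Fin H, k ∈ nbr G i) {V : ℕ}
    (φ : (Fin K → Bits V) → Fin K → Bits V) : Scheme G V where
  userBits _ := V
  upBits _ := K * V
  serverBits := K * V
  downBits _ := K * V
  -- Relays store nothing: the broadcast alone already carries every value.
  localCount _ := 0
  userEnc _ x := x
  localDec _ _ := fun _ _ => false
  upEnc i m := concat fun k => if h : k ∈ nbr G i then m ⟨k, h⟩ else fun _ => false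
  -- The value of each user is read from one chosen relay connected to it; blocks of unconnected
  -- users are only zero padding.
  serverEnc m := concat fun k => split (m (hcover k).choose) k
  relayDec _ x _ := split x
  downEnc _ x _ := x
  userDec k m := φ (split (m ⟨(hcover k).choose, (hcover k).choose_spec⟩)) k

/-- Needed only to make the sets of achievable loads nonempty: the real `sInf` of an empty set is
`0`, which would break the lower bounds. -/
theorem uncodedScheme_correct {H K : ℕ} (G : Matrix (Fin H) (Fin K) ℕ)
    (hcover : ∀ k : Fin K, ∃ i : Fin H, k ∈ nbr G i) {V : ℕ}
    (φ : (Fin K → Bits V) → Fin K → Bits V) : (uncodedScheme G hcover φ).Correct φ := by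
  intro v
  have hsrv : (uncodedScheme G hcover φ).serverMsg v = concat v := by
    change concat (K := K) (V := V) (fun k => split (concat (K := K) (V := V) fun l =>
      if l ∈ nbr G (hcover k).choose then v l else fun _ => false) k) = concat v
    refine congrArg concat (funext fun k => ?_)
    rw [split_concat]
    exact if_pos (hcover k).choose_spec
  have hmsg : split (K := K) (V := V) ((uncodedScheme G hcover φ).serverMsg v) = v :=
    (congrArg split hsrv).trans (split_concat v)
  exact ⟨fun _ => hmsg, fun k => congrArg (fun x => φ x k) hmsg⟩

/-! ### Bounds on the optimal loads -/

theorem exists_minUsers_eq {H K : ℕ} (hH : 0 < H) (G : Matrix (Fin H) (Fin K) ℕ) :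
    ∃ i, (nbr G i).card = minUsers G := by
  have : Nonempty (Fin H) := ⟨⟨0, hH⟩⟩
  exact exists_eq_ciInf_of_finite

theorem le_optUplinkLoad {H K : ℕ} (hH : 0 < H) (G : Matrix (Fin H) (Fin K) ℕ)
    (hcover : ∀ k : Fin K, ∃ i : Fin H, k ∈ nbr G i)
    (φ : ∀ V : ℕ, (Fin K → Bits V) → Fin K → Bits V) :
    (K : ℝ) - minUsers G ≤ optUplinkLoad G φ := by
  obtain ⟨i, hi⟩ := exists_minUsers_eq hH G
  refine le_csInf ⟨_, 1, one_pos, uncodedScheme G hcover (φ 1),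
    uncodedScheme_correct G hcover (φ 1), rfl⟩ ?_
  rintro _ ⟨V, hV, S, hS, rfl⟩
  have h := le_load_of_mul_le hV (Scheme.le_sum_upBits hS i)
  rw [hi] at h
  simpa [Scheme.uplinkLoad] using h

theorem le_optDownlinkLoad {H K : ℕ} (hH : 0 < H) (G : Matrix (Fin H) (Fin K) ℕ)
    (hcover : ∀ k : Fin K, ∃ i : Fin H, k ∈ nbr G i)
    (φ : ∀ V : ℕ, (Fin K → Bits V) → Fin K → Bits V) :
    (K : ℝ) - minUsers G ≤ optDownlinkLoad G φ := by
  obtain ⟨i, hi⟩ := exists_minUsers_eq hH G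
  refine le_csInf ⟨_, 1, one_pos, uncodedScheme G hcover (φ 1),
    uncodedScheme_correct G hcover (φ 1), rfl⟩ ?_
  rintro _ ⟨V, hV, S, hS, rfl⟩
  have h := le_load_of_mul_le hV (Scheme.le_serverBits hS i)
  rwa [hi] at h

/-! ### Uniform splitting -/

/-- Exactly `z` relays know a user of `ℐ z`, and each contributes `1 / z`, so every covering
constraint is tight. -/
theorem feasible_uniform {H K : ℕ} (G : Matrix (Fin H) (Fin K) ℕ) {z : ℕ} (hz : 1 ≤ z) :
    Feasible G z fun _ => 1 / (z : ℝ) := by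
  have hz' : (1 : ℝ) ≤ z := by exact_mod_cast hz
  refine ⟨fun k hk => ?_, fun _ => ⟨by positivity, ?_⟩⟩
  · have h : connectivity G k = z := by simpa [zConn] using hk
    rw [connectivity] at h
    rw [← Finset.sum_filter, Finset.sum_const, h, nsmul_eq_mul, mul_one_div_cancel (by positivity)]
  · rw [div_le_one (by positivity)]
    exact hz'

/-- Double counting of the links of the users in `ℐ z`. -/
theorem sum_card_nbr_inter_zConn {H K : ℕ} (G : Matrix (Fin H) (Fin K) ℕ) (z : ℕ) :
    ∑ i, (nbr G i ∩ zConn G z).card = z * (zConn G z).card := by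
  have h := Finset.sum_card_bipartiteAbove_eq_sum_card_bipartiteBelow
    (s := (Finset.univ : Finset (Fin H))) (t := zConn G z) (fun i k => k ∈ nbr G i)
  calc ∑ i, (nbr G i ∩ zConn G z).card
      = ∑ i, (Finset.bipartiteAbove (fun i k => k ∈ nbr G i) (zConn G z) i).card := by
        refine Finset.sum_congr rfl fun i _ => congrArg Finset.card ?_
        ext k
        simp [Finset.bipartiteAbove, and_comm]
    _ = ∑ k ∈ zConn G z, connectivity G k := h
    _ = ∑ k ∈ zConn G z, z := Finset.sum_congr rfl fun k hk => by simpa [zConn] using hk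
    _ = z * (zConn G z).card := by rw [Finset.sum_const, smul_eq_mul, mul_comm]

theorem roundLoad_uniform {H K : ℕ} (G : Matrix (Fin H) (Fin K) ℕ) {z : ℕ} (hz : 1 ≤ z) :
    roundLoad G z (fun _ => 1 / (z : ℝ)) =
      (zConn G z).card - ∑ i, (1 / (z : ℝ)) * (minCommon G z i : ℝ) := by
  have hz' : (z : ℝ) ≠ 0 := by positivity
  have h : ∑ i, ((nbr G i ∩ zConn G z).card : ℝ) = z * (zConn G z).card := by
    exact_mod_cast sum_card_nbr_inter_zConn G z
  simp only [roundLoad, numComb, mul_sub, Finset.sum_sub_distrib]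
  rw [← Finset.mul_sum, h, ← mul_assoc, one_div_mul_cancel hz', one_mul]

/-- A user has only one connectivity, so the classes are disjoint. -/
theorem sum_card_zConn_le {H K : ℕ} (G : Matrix (Fin H) (Fin K) ℕ) (s : Finset ℕ) :
    ∑ z ∈ s, (zConn G z).card ≤ K := by
  rw [← Finset.card_biUnion]
  · exact (Finset.card_le_univ _).trans_eq (Fintype.card_fin K)
  · intro y _ z _ hyz
    refine Finset.disjoint_left.2 fun k hy hz => hyz ?_
    simp only [zConn, Finset.mem_filter, Finset.mem_univ, true_and] at hy hz
    exact hy.symm.trans hz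

theorem codedUplinkLoad_le {H K : ℕ} (G : Matrix (Fin H) (Fin K) ℕ) {α : ℕ → Fin H → ℝ}
    (hα : ∀ z ∈ Finset.Icc 1 (H - 1), IsOptimalSplit G z (α z)) :
    codedUplinkLoad G α ≤ (K : ℝ) -
      ∑ z ∈ Finset.Icc 1 (H - 1), ∑ i : Fin H, (1 / (z : ℝ)) * (minCommon G z i : ℝ) := by
  have hK : ∑ z ∈ Finset.Icc 1 (H - 1), ((zConn G z).card : ℝ) ≤ K := by
    exact_mod_cast sum_card_zConn_le G _
  calc codedUplinkLoad G α
      ≤ ∑ z ∈ Finset.Icc 1 (H - 1),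
          ((zConn G z).card - ∑ i, (1 / (z : ℝ)) * (minCommon G z i : ℝ)) := by
        refine Finset.sum_le_sum fun z hz => ?_
        have hz1 := (Finset.mem_Icc.1 hz).1
        rw [← roundLoad_uniform G hz1]
        exact (hα z hz).2 _ (feasible_uniform G hz1)
    _ ≤ _ := by
        rw [Finset.sum_sub_distrib]
        linarith

end HierMTL

theorem corollary1 {H K : ℕ} (hH : 0 < H) (hK : 0 < K)
    (G : Matrix (Fin H) (Fin K) ℕ)
    (hG : ∀ i k, G i k = 0 ∨ G i k = 1)
    (hcover : ∀ k : Fin K, ∃ i : Fin H, k ∈ HierMTL.nbr G i)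
    (φ : ∀ V : ℕ, (Fin K → HierMTL.Bits V) → Fin K → HierMTL.Bits V)
    (α : ℕ → Fin H → ℝ)
    (hα : ∀ z ∈ Finset.Icc 1 (H - 1), HierMTL.IsOptimalSplit G z (α z)) :
    (HierMTL.codedUplinkLoad G α - HierMTL.optUplinkLoad G φ
        ≤ (HierMTL.minUsers G : ℝ)
          - ∑ z ∈ Finset.Icc 1 (H - 1), ∑ i : Fin H,
              (1 / (z : ℝ)) * (HierMTL.minCommon G z i : ℝ) ∧
      (HierMTL.minUsers G : ℝ)
          - ∑ z ∈ Finset.Icc 1 (H - 1), ∑ i : Fin H,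
              (1 / (z : ℝ)) * (HierMTL.minCommon G z i : ℝ)
        ≤ (HierMTL.minUsers G : ℝ)) ∧
    (HierMTL.codedDownlinkLoad G - HierMTL.optDownlinkLoad G φ
        ≤ (HierMTL.minUsers G : ℝ)
          - ∑ z ∈ Finset.Icc 1 (H - 1), (HierMTL.minLocal G z : ℝ) ∧
      (HierMTL.minUsers G : ℝ)
          - ∑ z ∈ Finset.Icc 1 (H - 1), (HierMTL.minLocal G z : ℝ)
        ≤ (HierMTL.minUsers G : ℝ)) := by
  have hup := HierMTL.le_optUplinkLoad hH G hcover φ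
  have hdown := HierMTL.le_optDownlinkLoad hH G hcover φ
  have hcoded := HierMTL.codedUplinkLoad_le G hα
  have hcommon : 0 ≤ ∑ z ∈ Finset.Icc 1 (H - 1), ∑ i : Fin H,
      (1 / (z : ℝ)) * (HierMTL.minCommon G z i : ℝ) := by positivity
  have hlocal : 0 ≤ ∑ z ∈ Finset.Icc 1 (H - 1), (HierMTL.minLocal G z : ℝ) := by positivity
  refine ⟨⟨by linarith, by linarith⟩, ?_, by linarith⟩
  -- The coded downlink load is `K` minus the savings by definition, so the lower bound suffices and
  -- no linear program enters.
  rw [HierMTL.codedDownlinkLoad]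
  linarith
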